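/- Let $E$ and $F$ be real Banach lattices such that the norm dual $E^*$ (with its canonical order) is a KB-space, i.e. every norm bounded increasing sequence in $E^*_+$ is norm convergent, and such that $F$ is Dedekind complete. Call a bounded linear operator $T:E\to F$ *M-weakly compact* if $\|Tx_n\|\to 0$ for every disjoint norm bounded sequence $(x_n)$ in $E$, and *almost M-weakly compact* if $f_n(Tx_n)\to 0$ for every weakly convergent sequence $(f_n)$ in $F^*$ and every disjoint norm bounded sequence $(x_n)$ in $E$. Suppose that every positive almost M-weakly compact operator $T:E\to F$ is M-weakly compact. Then $E$ has the positive Schur property (every weakly null sequence of positive elements of $E$ is norm null), or $F=F^a$, where $$F^a=\{x\in F:\ \|x_n\|\to 0 \text{ for every sequence } (x_n) \text{ in } F \text{ with } |x|\ge x_n\downarrow 0\}$$ is the order continuous part of $F$ (for Dedekind complete $F$, $F=F^a$ says that the norm of $F$ is order continuous). Here $x_n\downarrow 0$ means that $(x_n)$ is decreasing with infimum $0$. -/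

import Mathlib

open Filter Topology

namespace BanachLattice

section Weak

variable {X : Type*} [NormedAddCommGroup X] [NormedSpace ℝ X]

/-- The sequence `x` converges weakly to `a`, i.e. in the topology `σ(X, X*)`. -/
def WeaklyConvergesTo (x : ℕ → X) (a : X) : Prop :=
  Tendsto (fun n => toWeakSpace ℝ X (x n)) atTop (𝓝 (toWeakSpace ℝ X a))

theorem weaklyConvergesTo_iff (x : ℕ → X) (a : X) :
    WeaklyConvergesTo x a ↔
      ∀ f : StrongDual ℝ X, Tendsto (fun n => f (x n)) atTop (𝓝 (f a)) :=
  WeakBilin.tendsto_iff_forall_eval_tendsto (topDualPairing ℝ X).flip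
    (fun _ _ h => by
      by_contra hne
      obtain ⟨f, hf⟩ := SeparatingDual.exists_separating_of_ne (R := ℝ) hne
      exact hf (LinearMap.congr_fun h f))

end Weak

section Dual

/-- The canonical order of the norm dual of an ordered normed space:
`f ≤ g` iff `f x ≤ g x` for all `x ≥ 0`. (Antisymmetry holds because `x = x⁺ - x⁻`.) -/
@[reducible] def dualPartialOrder (E : Type*) [NormedAddCommGroup E] [NormedSpace ℝ E]
    [Lattice E] [IsOrderedAddMonoid E] : PartialOrder (StrongDual ℝ E) where
  le f g := ∀ x : E, 0 ≤ x → f x ≤ g x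
  le_refl _ _ _ := le_rfl
  le_trans _ _ _ h₁ h₂ x hx := (h₁ x hx).trans (h₂ x hx)
  le_antisymm f g h₁ h₂ := by
    ext x
    have hp := le_antisymm (h₁ _ (posPart_nonneg x)) (h₂ _ (posPart_nonneg x))
    have hn := le_antisymm (h₁ _ (negPart_nonneg x)) (h₂ _ (negPart_nonneg x))
    rw [← posPart_sub_negPart x, map_sub, map_sub, hp, hn]

end Dual

section Spaces

/-- KB-space: every norm bounded increasing sequence of positive elements is norm convergent. -/
def IsKBSpace (X : Type*) [NormedAddCommGroup X] [PartialOrder X] : Prop :=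
  ∀ u : ℕ → X, (∀ n, 0 ≤ u n) → Monotone u → Bornology.IsBounded (Set.range u) →
    ∃ a : X, Tendsto u atTop (𝓝 a)

/-- Every nonempty subset that is bounded above has a supremum. -/
def IsDedekindComplete (F : Type*) [PartialOrder F] : Prop :=
  ∀ s : Set F, s.Nonempty → BddAbove s → ∃ a : F, IsLUB s a

/-- Positive Schur property: positive weakly null sequences are norm null. -/
def HasPositiveSchurProperty (E : Type*) [NormedAddCommGroup E] [NormedSpace ℝ E]
    [PartialOrder E] : Prop :=
  ∀ x : ℕ → E, (∀ n, 0 ≤ x n) → WeaklyConvergesTo x 0 → Tendsto (fun n => ‖x n‖) atTop (𝓝 0)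

/-- The order continuous part `E^a = {x : |x| ≥ xₙ ↓ 0 implies ‖xₙ‖ → 0}`, where `xₙ ↓ 0` means
that the sequence is decreasing with infimum `0`. -/
def orderContinuousPart (E : Type*) [NormedAddCommGroup E] [Lattice E] : Set E :=
  {x | ∀ u : ℕ → E, (∀ n, u n ≤ |x|) → Antitone u → IsGLB (Set.range u) 0 →
    Tendsto (fun n => ‖u n‖) atTop (𝓝 0)}

/-- Disjoint sequence: `|xₘ| ⊓ |xₙ| = 0` for `m ≠ n`. -/
def IsDisjointSeq {E : Type*} [AddCommGroup E] [Lattice E] (x : ℕ → E) : Prop :=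
  ∀ m n : ℕ, m ≠ n → |x m| ⊓ |x n| = 0

end Spaces

section Operators

/-- A positive operator maps positive elements to positive elements. -/
def IsPositiveOperator {E F : Type*} [NormedAddCommGroup E] [NormedSpace ℝ E] [PartialOrder E]
    [NormedAddCommGroup F] [NormedSpace ℝ F] [PartialOrder F] (T : E →L[ℝ] F) : Prop :=
  ∀ x : E, 0 ≤ x → 0 ≤ T x

variable {E Y : Type*} [NormedAddCommGroup E] [NormedSpace ℝ E] [Lattice E]
  [NormedAddCommGroup Y] [NormedSpace ℝ Y]

/-- M-weakly compact operator: `‖T xₙ‖ → 0` for every disjoint norm bounded sequence `xₙ`. -/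
def IsMWeaklyCompact (T : E →L[ℝ] Y) : Prop :=
  ∀ x : ℕ → E, IsDisjointSeq x → Bornology.IsBounded (Set.range x) →
    Tendsto (fun n => ‖T (x n)‖) atTop (𝓝 0)

/-- Almost M-weakly compact operator: `fₙ (T xₙ) → 0` for every weakly (i.e. `σ(Y*, Y**)`)
convergent sequence `fₙ` in `Y*` and every disjoint norm bounded sequence `xₙ`. -/
def IsAlmostMWeaklyCompact (T : E →L[ℝ] Y) : Prop :=
  ∀ (f : ℕ → StrongDual ℝ Y) (g : StrongDual ℝ Y) (x : ℕ → E), WeaklyConvergesTo f g →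
    IsDisjointSeq x → Bornology.IsBounded (Set.range x) →
      Tendsto (fun n => f n (T (x n))) atTop (𝓝 0)

end Operators

end BanachLattice

/-!
The proof is by contraposition: if `E` fails the positive Schur property and `F ≠ F^a`, a positive
operator `T : E → F` is constructed that is almost M-weakly compact but not M-weakly compact.

Failure of the positive Schur property makes `E` infinite dimensional, so `E` contains a disjoint
sequence `x n` of positive unit vectors (`exists_disjoint_seq_of_not_finiteDimensional`). Choose
positive functionals `f n` with `‖f n‖ ≤ 1` and `f n (x n) = 1`. On the other side, `F ≠ F^a` yields
positive `v n` with `‖v n‖ ≥ δ > 0` whose partial sums are bounded by some `e`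
(`exists_bounded_series_of_orderContinuousPart_ne_univ`); disjointness of the `v n` is not needed.
Dedekind completeness of `F` makes `T x = ∑ f n x • v n` meaningful as an order limit
(`exists_orderSeries_operator`), and `‖T (x n)‖ ≥ ‖f n (x n) • v n‖ ≥ δ`.

That `T` is almost M-weakly compact rests on `T x ≤ ‖x‖ • e` for `x ≥ 0` and on two facts.

* If `E*` is a KB-space, positive functionals tend to zero along bounded disjoint sequences
  (`tendsto_zero_of_disjoint_nonneg`). Hence positive functionals on `F` tend to zero along
  `z n = T (y n)` for `y n ≥ 0` bounded and disjoint.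
* A form of the Dunford–Pettis property (`tendsto_zero_of_weaklyNull`): if moreover `0 ≤ z n ≤ e`,
  then `g n (z n) → 0` for every weakly null sequence `g n` in `F*`. After passing to a subsequence
  along which `|g m| (z n)` is tiny for `m < n`, the elements `z n` may be replaced by the increments
  `sup_{k ≥ n} z k - sup_{k > n} z k`, which are positive with sums at most `e`. The suprema are taken
  over finitely many terms; a weak* limit in `F**` along an ultrafilter then assigns to each set `S`
  of indices an element of `F**`, the sum of the increments over `S`. Evaluation at `g n` gives
  additive set functions that tend to zero setwise and have small tails, so that the gliding hump
  `false_of_setwise_null_of_diagonal` applies.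
-/

namespace BanachLattice

/-! ### Vector lattice inequalities -/

section LatticeGroup

variable {G : Type*} [AddCommGroup G] [Lattice G] [IsOrderedAddMonoid G]

theorem add_inf_le_inf_add_inf {x y z : G} (hx : 0 ≤ x) (hy : 0 ≤ y) (hz : 0 ≤ z) :
    (x + y) ⊓ z ≤ x ⊓ z + y ⊓ z := by
  rw [inf_add, add_inf, add_inf]
  refine le_inf (le_inf inf_le_left (inf_le_right.trans (le_add_of_nonneg_left hx)))
    (le_inf (inf_le_right.trans (le_add_of_nonneg_right hy))
      (inf_le_right.trans (le_add_of_nonneg_left hz)))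

theorem inf_add_inf_le_add_inf_add (x y z w : G) :
    x ⊓ z + y ⊓ w ≤ (x + y) ⊓ (z + w) :=
  le_inf (add_le_add inf_le_left inf_le_left) (add_le_add inf_le_right inf_le_right)

theorem nsmul_inf_eq_zero {a b : G} (ha : 0 ≤ a) (hb : 0 ≤ b) (h : a ⊓ b = 0) (m : ℕ) :
    (m • a) ⊓ b = 0 := by
  induction m with
  | zero => simpa using hb
  | succ m ih =>
    refine le_antisymm ?_ (le_inf (nsmul_nonneg ha _) hb)
    rw [succ_nsmul]
    refine (add_inf_le_inf_add_inf (nsmul_nonneg ha m) ha hb).trans ?_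
    rw [ih, h, add_zero]

theorem nsmul_inf_nsmul_eq_zero {a b : G} (ha : 0 ≤ a) (hb : 0 ≤ b) (h : a ⊓ b = 0) (m n : ℕ) :
    (m • a) ⊓ (n • b) = 0 := by
  have h1 := nsmul_inf_eq_zero ha hb h m
  rw [inf_comm] at h1 ⊢
  exact nsmul_inf_eq_zero hb (nsmul_nonneg ha m) h1 n

theorem smul_inf_smul_eq_zero [Module ℝ G] [IsOrderedModule ℝ G] {a b : G} (ha : 0 ≤ a)
    (hb : 0 ≤ b) (h : a ⊓ b = 0) {c d : ℝ} (hc : 0 ≤ c) (hd : 0 ≤ d) :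
    (c • a) ⊓ (d • b) = 0 := by
  have hle : ∀ (r : ℝ) (u : G), 0 ≤ u → r • u ≤ ⌈r⌉₊ • u := fun r u hu => by
    rw [← Nat.cast_smul_eq_nsmul ℝ]
    exact smul_le_smul_of_nonneg_right (Nat.le_ceil r) hu
  refine le_antisymm ?_ (le_inf (smul_nonneg hc ha) (smul_nonneg hd hb))
  rw [← nsmul_inf_nsmul_eq_zero ha hb h ⌈c⌉₊ ⌈d⌉₊]
  exact inf_le_inf (hle c a ha) (hle d b hb)

theorem sum_inf_eq_zero {ι : Type*} {a : ι → G} {b : G} (s : Finset ι) (ha : ∀ i ∈ s, 0 ≤ a i)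
    (hb : 0 ≤ b) (h : ∀ i ∈ s, a i ⊓ b = 0) : (∑ i ∈ s, a i) ⊓ b = 0 := by
  classical
  induction s using Finset.induction_on with
  | empty => simpa using hb
  | insert j s hj ih =>
    rw [Finset.forall_mem_insert] at ha h
    refine le_antisymm ?_ (le_inf (Finset.sum_nonneg (by simpa using ha)) hb)
    rw [Finset.sum_insert hj]
    refine (add_inf_le_inf_add_inf ha.1 (Finset.sum_nonneg ha.2) hb).trans ?_
    rw [ih ha.2 h.2, h.1, add_zero]

/-- A finite sum of pairwise disjoint positive elements lies below every common upper bound, since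
such a sum is a supremum. -/
theorem sum_le_of_disjoint {ι : Type*} {a : ι → G} {x : G} (s : Finset ι) (hx : 0 ≤ x)
    (ha : ∀ i ∈ s, 0 ≤ a i) (hax : ∀ i ∈ s, a i ≤ x)
    (h : ∀ i ∈ s, ∀ j ∈ s, i ≠ j → a i ⊓ a j = 0) : ∑ i ∈ s, a i ≤ x := by
  classical
  induction s using Finset.induction_on with
  | empty => simpa using hx
  | insert j s hj ih =>
    have hs : ∀ i ∈ s, i ≠ j := fun i hi e => hj (e ▸ hi)
    have h0 : (∑ i ∈ s, a i) ⊓ a j = 0 :=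
      sum_inf_eq_zero s (fun i hi => ha i (Finset.mem_insert_of_mem hi))
        (ha j (Finset.mem_insert_self j s))
        (fun i hi => h i (Finset.mem_insert_of_mem hi) j (Finset.mem_insert_self j s) (hs i hi))
    rw [Finset.sum_insert hj, add_comm, ← inf_add_sup, h0, zero_add]
    refine sup_le (ih (fun i hi => ha i (Finset.mem_insert_of_mem hi))
      (fun i hi => hax i (Finset.mem_insert_of_mem hi))
      fun i hi k hk => h i (Finset.mem_insert_of_mem hi) k (Finset.mem_insert_of_mem hk))
      (hax j (Finset.mem_insert_self j s))

/-- Riesz decomposition of an order interval: `[-(x + y), x + y] = [-x, x] + [-y, y]`. -/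
theorem exists_add_eq_of_mem_Icc {x y w : G} (hx : 0 ≤ x) (hy : 0 ≤ y)
    (hw : w ∈ Set.Icc (-(x + y)) (x + y)) :
    ∃ u ∈ Set.Icc (-x) x, ∃ v ∈ Set.Icc (-y) y, u + v = w := by
  have hxx : -x ≤ x := (neg_nonpos.2 hx).trans hx
  refine ⟨(w ⊓ x) ⊔ (-x), ⟨le_sup_right, sup_le inf_le_right hxx⟩,
    w - ((w ⊓ x) ⊔ (-x)), ⟨?_, ?_⟩, by abel⟩
  · have h1 : (w ⊓ x) ⊔ (-x) ≤ w + y := by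
      refine sup_le (inf_le_left.trans (le_add_of_nonneg_right hy)) ?_
      have := hw.1
      rwa [neg_add, ← sub_eq_add_neg, sub_le_iff_le_add] at this
    exact neg_le_sub_iff_le_add.2 h1
  · have h1 : w - y ≤ (w ⊓ x) ⊔ (-x) := by
      refine le_sup_of_le_left (le_inf (sub_le_self w hy) ?_)
      exact sub_le_iff_le_add.2 hw.2
    exact sub_le_comm.1 h1

theorem posPart_le_abs (x : G) : x⁺ ≤ |x| := sup_le (le_abs_self x) (abs_nonneg x)

theorem negPart_le_abs (x : G) : x⁻ ≤ |x| := sup_le (neg_le_abs x) (abs_nonneg x)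

end LatticeGroup

section SolidNorm

variable {E : Type*} [NormedAddCommGroup E] [Lattice E] [IsOrderedAddMonoid E] [HasSolidNorm E]

theorem norm_le_norm_of_nonneg_of_le {x y : E} (hx : 0 ≤ x) (h : x ≤ y) : ‖x‖ ≤ ‖y‖ :=
  norm_le_norm_of_abs_le_abs (by rwa [abs_of_nonneg hx, abs_of_nonneg (hx.trans h)])

theorem norm_le_norm_of_mem_Icc_neg {w x : E} (h : w ∈ Set.Icc (-x) x) : ‖w‖ ≤ ‖x‖ :=
  norm_le_norm_of_abs_le_abs ((abs_le'.2 ⟨h.2, neg_le.1 h.1⟩).trans (le_abs_self x))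

theorem norm_posPart_le (x : E) : ‖x⁺‖ ≤ ‖x‖ :=
  norm_le_norm_of_abs_le_abs (by
    rw [abs_of_nonneg (posPart_nonneg x)]; exact posPart_le_abs x)

theorem norm_negPart_le (x : E) : ‖x⁻‖ ≤ ‖x‖ :=
  norm_le_norm_of_abs_le_abs (by
    rw [abs_of_nonneg (negPart_nonneg x)]; exact negPart_le_abs x)

end SolidNorm

/-! ### Operators determined on the positive cone -/

theorem map_mono_of_nonneg {E : Type*} [NormedAddCommGroup E] [NormedSpace ℝ E] [Lattice E]
    [IsOrderedAddMonoid E] {f : StrongDual ℝ E} (hf : ∀ x, 0 ≤ x → 0 ≤ f x) {x y : E}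
    (h : x ≤ y) : f x ≤ f y := by
  have := hf _ (sub_nonneg.2 h)
  rw [map_sub] at this
  linarith

section Extension

variable {E : Type*} [NormedAddCommGroup E] [NormedSpace ℝ E] [Lattice E] [IsOrderedAddMonoid E]
  [HasSolidNorm E]

/-- A bounded additive map on the positive cone extends to a bounded operator, by
`x ↦ φ x⁺ - φ x⁻`. -/
theorem exists_continuousLinearMap_of_additive_on_nonneg {Y : Type*} [NormedAddCommGroup Y]
    [NormedSpace ℝ Y] (φ : E → Y) (hadd : ∀ x y, 0 ≤ x → 0 ≤ y → φ (x + y) = φ x + φ y) (C : ℝ)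
    (hC : ∀ x, 0 ≤ x → ‖φ x‖ ≤ C * ‖x‖) : ∃ T : E →L[ℝ] Y, ∀ x, 0 ≤ x → T x = φ x := by
  have hC' : ∀ x, 0 ≤ x → ‖φ x‖ ≤ |C| * ‖x‖ := fun x hx =>
    (hC x hx).trans (mul_le_mul_of_nonneg_right (le_abs_self C) (norm_nonneg x))
  have h0 : φ 0 = 0 := by simpa using hadd 0 0 le_rfl le_rfl
  have key : ∀ a b : E, 0 ≤ a → 0 ≤ b → φ (a - b)⁺ - φ (a - b)⁻ = φ a - φ b := by
    intro a b ha hb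
    have h1 : (a - b)⁺ + b = a + (a - b)⁻ := by
      have := posPart_sub_negPart (a - b)
      rw [sub_eq_sub_iff_add_eq_add] at this
      exact this
    have h2 := hadd _ _ (posPart_nonneg (a - b)) hb
    rw [h1, hadd _ _ ha (negPart_nonneg _)] at h2
    rw [sub_eq_sub_iff_add_eq_add]
    exact h2.symm
  let A : E →+ Y := AddMonoidHom.mk' (fun x => φ x⁺ - φ x⁻) (by
    intro x y
    have h1 : x + y = (x⁺ + y⁺) - (x⁻ + y⁻) := by
      conv_lhs => rw [← posPart_sub_negPart x, ← posPart_sub_negPart y]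
      abel
    have hp : 0 ≤ x⁺ + y⁺ := add_nonneg (posPart_nonneg x) (posPart_nonneg y)
    have hn : 0 ≤ x⁻ + y⁻ := add_nonneg (negPart_nonneg x) (negPart_nonneg y)
    rw [h1, key _ _ hp hn, hadd _ _ (posPart_nonneg x) (posPart_nonneg y),
      hadd _ _ (negPart_nonneg x) (negPart_nonneg y)]
    abel)
  have hA : Continuous A := by
    refine AddMonoidHomClass.continuous_of_bound A (2 * |C|) fun x => ?_
    change ‖φ x⁺ - φ x⁻‖ ≤ _
    have h1 := (hC' _ (posPart_nonneg x)).trans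
      (mul_le_mul_of_nonneg_left (norm_posPart_le x) (abs_nonneg C))
    have h2 := (hC' _ (negPart_nonneg x)).trans
      (mul_le_mul_of_nonneg_left (norm_negPart_le x) (abs_nonneg C))
    linarith [norm_sub_le (φ x⁺) (φ x⁻)]
  refine ⟨A.toRealLinearMap hA, fun x hx => ?_⟩
  change φ x⁺ - φ x⁻ = φ x
  rw [posPart_eq_self.2 hx, negPart_eq_zero.2 hx, h0, sub_zero]

/-- The modulus of a functional `g`, given on the positive cone by
`x ↦ sup {g w : -x ≤ w ≤ x}`. -/
theorem exists_modulus (g : StrongDual ℝ E) :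
    ∃ P : StrongDual ℝ E, (∀ x, 0 ≤ x → |g x| ≤ P x) ∧ ∀ x, 0 ≤ x → P x ≤ ‖g‖ * ‖x‖ := by
  have hne : ∀ x : E, 0 ≤ x → (g '' Set.Icc (-x) x).Nonempty := fun x hx =>
    ⟨_, Set.mem_image_of_mem g (⟨(neg_nonpos.2 hx).trans hx, le_rfl⟩ : x ∈ Set.Icc (-x) x)⟩
  have hub : ∀ x : E, ∀ r ∈ g '' Set.Icc (-x) x, r ≤ ‖g‖ * ‖x‖ := by
    rintro x _ ⟨w, hw, rfl⟩
    refine (le_abs_self _).trans ((g.le_opNorm w).trans ?_)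
    exact mul_le_mul_of_nonneg_left (norm_le_norm_of_mem_Icc_neg hw) (norm_nonneg g)
  have hbdd : ∀ x : E, BddAbove (g '' Set.Icc (-x) x) := fun x => ⟨_, hub x⟩
  have habs : ∀ x : E, 0 ≤ x → |g x| ≤ sSup (g '' Set.Icc (-x) x) := by
    intro x hx
    have hxx : -x ≤ x := (neg_nonpos.2 hx).trans hx
    refine abs_le'.2 ⟨le_csSup (hbdd x) ⟨x, ⟨hxx, le_rfl⟩, rfl⟩, ?_⟩
    exact le_csSup (hbdd x) ⟨-x, ⟨le_rfl, hxx⟩, map_neg g x⟩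
  obtain ⟨P, hP⟩ := exists_continuousLinearMap_of_additive_on_nonneg
    (fun x : E => sSup (g '' Set.Icc (-x) x)) (fun x y hx hy => by
      rw [← csSup_add (hne x hx) (hbdd x) (hne y hy) (hbdd y)]
      congr 1
      ext r
      constructor
      · rintro ⟨w, hw, rfl⟩
        obtain ⟨u, hu, v, hv, rfl⟩ := exists_add_eq_of_mem_Icc hx hy hw
        exact ⟨g u, ⟨u, hu, rfl⟩, g v, ⟨v, hv, rfl⟩, (map_add g u v).symm⟩
      · rintro ⟨_, ⟨u, hu, rfl⟩, _, ⟨v, hv, rfl⟩, rfl⟩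
        refine ⟨u + v, ⟨?_, add_le_add hu.2 hv.2⟩, map_add g u v⟩
        rw [neg_add]
        exact add_le_add hu.1 hv.1) ‖g‖ (fun x hx => by
      rw [Real.norm_eq_abs, abs_of_nonneg ((abs_nonneg _).trans (habs x hx))]
      exact csSup_le (hne x hx) (hub x))
  refine ⟨P, fun x hx => ?_, fun x hx => ?_⟩
  · rw [hP x hx]; exact habs x hx
  · rw [hP x hx]; exact csSup_le (hne x hx) (hub x)

/-- Every positive `x` is normed by a positive functional `f` of norm at most one. -/
theorem exists_nonneg_functional_norming {x : E} (hx : 0 ≤ x) :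
    ∃ f : StrongDual ℝ E, (∀ y, 0 ≤ y → 0 ≤ f y) ∧ (∀ y, 0 ≤ y → f y ≤ ‖y‖) ∧ f x = ‖x‖ := by
  obtain ⟨g, hg, hgx⟩ := exists_dual_vector'' ℝ x
  obtain ⟨P, hP, hPg⟩ := exists_modulus g
  have hle : ∀ y, 0 ≤ y → P y ≤ ‖y‖ := fun y hy =>
    (hPg y hy).trans (mul_le_of_le_one_left (norm_nonneg y) hg)
  refine ⟨P, fun y hy => (abs_nonneg _).trans (hP y hy), hle, le_antisymm (hle x hx) ?_⟩
  have := (le_abs_self _).trans (hP x hx)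
  rwa [hgx] at this

end Extension

/-! ### Disjoint sequences under the KB-property of the dual -/

section KB

variable {E : Type*} [NormedAddCommGroup E] [NormedSpace ℝ E] [Lattice E] [IsOrderedAddMonoid E]
  [HasSolidNorm E]

/-- The component of the positive functional `f` carried by `y`, given on the positive cone by
`x ↦ lim f (x ⊓ m y)`. -/
theorem exists_component {f : StrongDual ℝ E} (hf : ∀ x, 0 ≤ x → 0 ≤ f x) {y : E} (hy : 0 ≤ y) :
    ∃ p : StrongDual ℝ E,
      ∀ x, 0 ≤ x → Tendsto (fun m : ℕ => f (x ⊓ m • y)) atTop (𝓝 (p x)) := by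
  have hnn : ∀ x : E, 0 ≤ x → ∀ m : ℕ, 0 ≤ x ⊓ m • y := fun x hx m =>
    le_inf hx (nsmul_nonneg hy m)
  have hub : ∀ x : E, ∀ m : ℕ, f (x ⊓ m • y) ≤ f x := fun x m =>
    map_mono_of_nonneg hf inf_le_left
  have hlim : ∀ x : E,
      Tendsto (fun m : ℕ => f (x ⊓ m • y)) atTop (𝓝 (⨆ m : ℕ, f (x ⊓ m • y))) := by
    intro x
    refine tendsto_atTop_ciSup (fun m n hmn => map_mono_of_nonneg hf ?_)
      ⟨f x, Set.forall_mem_range.2 (hub x)⟩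
    exact inf_le_inf_left x (nsmul_le_nsmul_left hy hmn)
  obtain ⟨p, hp⟩ := exists_continuousLinearMap_of_additive_on_nonneg
    (fun x : E => ⨆ m : ℕ, f (x ⊓ m • y)) (fun x z hx hz => by
      refine le_antisymm ?_ ?_
      · refine le_of_tendsto_of_tendsto' (hlim (x + z)) ((hlim x).add (hlim z)) fun m => ?_
        rw [← map_add]
        exact map_mono_of_nonneg hf (add_inf_le_inf_add_inf hx hz (nsmul_nonneg hy m))
      · have h2 : Tendsto (fun m : ℕ => m + m) atTop atTop :=
          tendsto_atTop_mono (fun m => Nat.le_add_left m m) tendsto_id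
        refine le_of_tendsto_of_tendsto' ((hlim x).add (hlim z)) ((hlim (x + z)).comp h2)
          fun m => ?_
        simp only [Function.comp_apply]
        rw [← map_add, add_nsmul]
        exact map_mono_of_nonneg hf (inf_add_inf_le_add_inf_add _ _ _ _)) ‖f‖ (fun x hx => by
      have h0 : 0 ≤ ⨆ m : ℕ, f (x ⊓ m • y) :=
        ge_of_tendsto' (hlim x) fun m => hf _ (hnn x hx m)
      rw [Real.norm_eq_abs, abs_of_nonneg h0]
      exact (le_of_tendsto' (hlim x) (hub x)).trans ((le_abs_self _).trans (f.le_opNorm x)))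
  exact ⟨p, fun x hx => by rw [hp x hx]; exact hlim x⟩

/-- If the dual is a KB-space, positive functionals tend to zero along bounded disjoint sequences
of positive elements: the components `p n` of `f` carried by the `y n` have increasing partial sums
dominated by `f`, so that these converge and `‖p n‖ → 0`, while `f (y n) = p n (y n)`. -/
theorem tendsto_zero_of_disjoint_nonneg
    (hE : @IsKBSpace (StrongDual ℝ E) _ (dualPartialOrder E))
    {f : StrongDual ℝ E} (hf : ∀ x, 0 ≤ x → 0 ≤ f x) {y : ℕ → E} (hy : ∀ n, 0 ≤ y n)
    (hd : ∀ m n, m ≠ n → y m ⊓ y n = 0) {C : ℝ} (hC : ∀ n, ‖y n‖ ≤ C) :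
    Tendsto (fun n => f (y n)) atTop (𝓝 0) := by
  choose p hp using fun n => exists_component hf (hy n)
  have hp0 : ∀ n x, 0 ≤ x → 0 ≤ p n x := fun n x hx =>
    ge_of_tendsto' (hp n x hx) fun m => hf _ (le_inf hx (nsmul_nonneg (hy n) m))
  have hpy : ∀ n, p n (y n) = f (y n) := fun n => by
    refine tendsto_nhds_unique (hp n _ (hy n)) (tendsto_const_nhds.congr' ?_)
    filter_upwards [eventually_ge_atTop 1] with m hm
    congr 1
    refine (inf_eq_left.2 ?_).symm
    simpa using nsmul_le_nsmul_left (hy n) hm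
  let S : ℕ → StrongDual ℝ E := fun N => ∑ n ∈ Finset.range N, p n
  have hS : ∀ N x, S N x = ∑ n ∈ Finset.range N, p n x := fun N x => by
    simp [S]
  have hS0 : ∀ N x, 0 ≤ x → 0 ≤ S N x := fun N x hx => by
    rw [hS]; exact Finset.sum_nonneg fun n _ => hp0 n x hx
  have hSf : ∀ N x, 0 ≤ x → S N x ≤ f x := by
    intro N x hx
    rw [hS]
    refine le_of_tendsto' (tendsto_finsetSum _ fun n _ => hp n x hx) fun m => ?_
    rw [← map_sum]
    refine map_mono_of_nonneg hf (sum_le_of_disjoint _ hx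
      (fun n _ => le_inf hx (nsmul_nonneg (hy n) m)) (fun n _ => inf_le_left) ?_)
    intro i _ j _ hij
    refine le_antisymm ?_ (le_inf (le_inf hx (nsmul_nonneg (hy i) m))
      (le_inf hx (nsmul_nonneg (hy j) m)))
    rw [← nsmul_inf_nsmul_eq_zero (hy i) (hy j) (hd i j hij) m m]
    exact inf_le_inf inf_le_right inf_le_right
  have hSb : ∀ N, ‖S N‖ ≤ 2 * ‖f‖ := by
    intro N
    refine ContinuousLinearMap.opNorm_le_bound _ (by positivity) fun x => ?_
    have h1 : ∀ z : E, 0 ≤ z → ‖z‖ ≤ ‖x‖ → |S N z| ≤ ‖f‖ * ‖x‖ := fun z hz hzx => by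
      rw [abs_of_nonneg (hS0 N z hz)]
      refine (hSf N z hz).trans ((le_abs_self _).trans ((f.le_opNorm z).trans ?_))
      exact mul_le_mul_of_nonneg_left hzx (norm_nonneg f)
    have h2 := h1 _ (posPart_nonneg x) (norm_posPart_le x)
    have h3 := h1 _ (negPart_nonneg x) (norm_negPart_le x)
    have h4 : S N x = S N x⁺ - S N x⁻ := by rw [← map_sub, posPart_sub_negPart]
    rw [h4, Real.norm_eq_abs]
    linarith [abs_sub (S N x⁺) (S N x⁻)]
  have hstep : ∀ N, S (N + 1) = S N + p N := fun N => Finset.sum_range_succ _ _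
  obtain ⟨a, ha⟩ := hE S (fun N => show ∀ x : E, 0 ≤ x → (0 : StrongDual ℝ E) x ≤ S N x from
      fun x hx => hS0 N x hx)
    (@monotone_nat_of_le_succ _ (dualPartialOrder E).toPreorder _ fun N =>
      show ∀ x : E, 0 ≤ x → S N x ≤ S (N + 1) x from fun x hx => by
        rw [hstep]; simpa using hp0 N x hx)
    (isBounded_iff_forall_norm_le.2 ⟨2 * ‖f‖, Set.forall_mem_range.2 hSb⟩)
  have hpn : Tendsto (fun n => ‖p n‖) atTop (𝓝 0) := by
    have h1 := ((ha.comp (tendsto_add_atTop_nat 1)).sub ha).norm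
    rw [sub_self, norm_zero] at h1
    refine h1.congr fun n => ?_
    simp only [Function.comp_apply]
    rw [hstep, add_sub_cancel_left]
  refine squeeze_zero (fun n => hf _ (hy n)) (fun n => ?_) (by simpa using hpn.mul_const C)
  rw [← hpy]
  exact (le_abs_self _).trans (((p n).le_opNorm _).trans
    (mul_le_mul_of_nonneg_left (hC n) (norm_nonneg _)))

end KB

/-! ### Disjoint sequences in infinite-dimensional normed lattices -/

section Discrete

variable {E : Type*} [NormedAddCommGroup E] [NormedSpace ℝ E] [Lattice E]

/-- A discrete element (an atom of the vector lattice): a positive nonzero element whose order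
interval consists of multiples of it. -/
def IsDiscreteElement (a : E) : Prop :=
  0 < a ∧ ∀ v, 0 ≤ v → v ≤ a → ∃ c : ℝ, v = c • a

variable [IsOrderedAddMonoid E] [IsOrderedModule ℝ E] [HasSolidNorm E]

/-- A positive element that is not discrete dominates two disjoint nonzero elements: if
`0 ≤ v ≤ u` and for every `t` one of `(v - t u)⁺`, `(v - t u)⁻` vanishes, then `v` is a multiple
of `u` by connectedness of `[0, 1]`. -/
theorem exists_disjoint_pair_of_not_isDiscreteElement {u : E} (hu : 0 < u)
    (h : ¬ IsDiscreteElement u) :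
    ∃ p q : E, (0 < p ∧ p ≤ u) ∧ (0 < q ∧ q ≤ u) ∧ p ⊓ q = 0 := by
  by_contra H
  refine h ⟨hu, fun v hv hvu => ?_⟩
  have hsplit : ∀ t ∈ Set.Icc (0 : ℝ) 1, t • u ≤ v ∨ v ≤ t • u := by
    intro t ht
    by_contra! hcon
    have htu : t • u ≤ u := by
      simpa using smul_le_smul_of_nonneg_right ht.2 hu.le
    refine H ⟨(v - t • u)⁺, (v - t • u)⁻, ⟨?_, ?_⟩, ⟨?_, ?_⟩, posPart_inf_negPart_eq_zero _⟩
    · refine lt_of_le_of_ne (posPart_nonneg _) fun e => hcon.2 ?_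
      exact sub_nonpos.1 (posPart_eq_zero.1 e.symm)
    · exact sup_le ((sub_le_self v (smul_nonneg ht.1 hu.le)).trans hvu) hu.le
    · refine lt_of_le_of_ne (negPart_nonneg _) fun e => hcon.1 ?_
      exact sub_nonneg.1 (negPart_eq_zero.1 e.symm)
    · refine sup_le ?_ hu.le
      rw [neg_sub]
      exact (sub_le_self _ hv).trans htu
  have hc : Continuous fun t : ℝ => t • u := by fun_prop
  obtain ⟨t, -, h1, h2⟩ := isPreconnected_closed_iff.1 (isPreconnected_Icc (a := (0 : ℝ)) (b := 1))
    {t | t • u ≤ v} {t | v ≤ t • u} (isClosed_le hc continuous_const)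
    (isClosed_le continuous_const hc) hsplit
    ⟨0, ⟨le_rfl, zero_le_one⟩, by simpa using hv⟩ ⟨1, ⟨zero_le_one, le_rfl⟩, by simpa using hvu⟩
  exact ⟨t, le_antisymm h2 h1⟩

theorem exists_disjoint_seq_of_forall_not_isDiscreteElement {x : E} (hx : 0 < x)
    (h : ∀ a, a ≤ x → ¬ IsDiscreteElement a) :
    ∃ y : ℕ → E, (∀ n, 0 < y n) ∧ ∀ m n, m ≠ n → y m ⊓ y n = 0 := by
  choose p q hp hq hpq using fun u : {u : E // 0 < u ∧ u ≤ x} =>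
    exists_disjoint_pair_of_not_isDiscreteElement u.2.1 (h u.1 u.2.2)
  let Q : {u : E // 0 < u ∧ u ≤ x} → {u : E // 0 < u ∧ u ≤ x} := fun u =>
    ⟨q u, (hq u).1, (hq u).2.trans u.2.2⟩
  -- the remainders `r n` decrease, and `p (r n)` is disjoint from `r (n + 1)`
  let r : ℕ → {u : E // 0 < u ∧ u ≤ x} := fun n => Q^[n] ⟨x, hx, le_rfl⟩
  have hr : ∀ n, (r (n + 1)).1 = q (r n) := fun n => by
    simp only [r, Function.iterate_succ_apply']; rfl
  have hanti : Antitone fun n => (r n).1 := antitone_nat_of_succ_le fun n => by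
    simp only [hr]; exact (hq _).2
  have hlt : ∀ m n, m < n → p (r m) ⊓ p (r n) = 0 := fun m n hmn => by
    refine le_antisymm ?_ (le_inf (hp _).1.le (hp _).1.le)
    rw [← hpq (r m), ← hr m]
    exact inf_le_inf_left _ ((hp _).2.trans (hanti hmn))
  refine ⟨fun n => p (r n), fun n => (hp _).1, fun m n hmn => ?_⟩
  rcases lt_or_gt_of_ne hmn with h1 | h1
  · exact hlt m n h1
  · rw [inf_comm]; exact hlt n m h1

theorem exists_max_smul_le {a x : E} (ha : 0 < a) (hx : 0 ≤ x) :
    ∃ c : ℝ, 0 ≤ c ∧ c • a ≤ x ∧ ∀ d : ℝ, 0 < d → ¬ d • a ≤ x - c • a := by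
  have hna : 0 < ‖a‖ := norm_pos_iff.2 ha.ne'
  let A : Set ℝ := {c | 0 ≤ c ∧ c • a ≤ x}
  have hA : IsClosed A := (isClosed_le continuous_const continuous_id).inter
    (isClosed_le (by fun_prop) continuous_const)
  have hb : BddAbove A := by
    refine ⟨‖x‖ / ‖a‖, fun c hc => ?_⟩
    have h1 := norm_le_norm_of_nonneg_of_le (smul_nonneg hc.1 ha.le) hc.2
    rw [norm_smul, Real.norm_of_nonneg hc.1] at h1
    rwa [le_div_iff₀ hna]
  have hm : sSup A ∈ A := hA.csSup_mem ⟨0, le_rfl, by simpa using hx⟩ hb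
  refine ⟨sSup A, hm.1, hm.2, fun d hd hda => ?_⟩
  have h2 : sSup A + d ∈ A := by
    refine ⟨add_nonneg hm.1 hd.le, ?_⟩
    rw [add_smul, add_comm]
    exact le_sub_iff_add_le.1 hda
  linarith [le_csSup hb h2]

/-- Subtracting maximal multiples of the elements of `s` one after the other leaves a remainder
that dominates no positive multiple of any of them. -/
theorem exists_mem_span_maximal (s : Finset E) (hs : ∀ a ∈ s, 0 < a) {x : E} (hx : 0 ≤ x) :
    ∃ z ∈ Submodule.span ℝ (s : Set E), z ≤ x ∧
      ∀ a ∈ s, ∀ d : ℝ, 0 < d → ¬ d • a ≤ x - z := by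
  classical
  induction s using Finset.induction_on with
  | empty => exact ⟨0, Submodule.zero_mem _, hx, by simp⟩
  | insert a s _ ih =>
    rw [Finset.forall_mem_insert] at hs
    obtain ⟨z, hz, hzx, hzs⟩ := ih hs.2
    obtain ⟨c, hc0, hc, hcm⟩ := exists_max_smul_le hs.1 (sub_nonneg.2 hzx)
    refine ⟨z + c • a, ?_, ?_, ?_⟩
    · rw [Finset.coe_insert]
      exact Submodule.add_mem _ (Submodule.span_mono (Set.subset_insert _ _) hz)
        (Submodule.smul_mem _ _ (Submodule.subset_span (Set.mem_insert _ _)))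
    · rw [add_comm]; exact le_sub_iff_add_le.1 hc
    · rw [Finset.forall_mem_insert]
      refine ⟨fun d hd hle => hcm d hd (by rwa [← sub_sub] at hle), fun b hb d hd hle => ?_⟩
      rw [← sub_sub] at hle
      exact hzs b hb d hd (hle.trans (sub_le_self _ (smul_nonneg hc0 hs.1.le)))

/-- If there is no infinite disjoint sequence, then every nonzero positive element dominates a
discrete one, finitely many discrete elements meet all the others, and these span the space. -/
theorem exists_disjoint_seq_of_not_finiteDimensional (h : ¬ FiniteDimensional ℝ E) :
    ∃ y : ℕ → E, (∀ n, 0 < y n) ∧ ∀ m n, m ≠ n → y m ⊓ y n = 0 := by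
  by_contra H
  have hdisc : ∀ x : E, 0 < x → ∃ a, a ≤ x ∧ IsDiscreteElement a := by
    intro x hx
    by_contra! hcon
    exact H (exists_disjoint_seq_of_forall_not_isDiscreteElement hx hcon)
  obtain ⟨s, hs, hmeet⟩ : ∃ s : Finset E, (∀ a ∈ s, IsDiscreteElement a) ∧
      ∀ b, IsDiscreteElement b → ∃ a ∈ s, a ⊓ b ≠ 0 := by
    by_contra! hcon
    obtain ⟨f, hf, hff⟩ := exists_seq_of_forall_finset_exists (IsDiscreteElement (E := E))
      (fun a b => a ⊓ b = 0) hcon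
    refine H ⟨f, fun n => (hf n).1, fun m n hmn => ?_⟩
    rcases lt_or_gt_of_ne hmn with h1 | h1
    · exact hff m n h1
    · rw [inf_comm]; exact hff n m h1
  have hspan : ∀ x : E, 0 ≤ x → x ∈ Submodule.span ℝ (s : Set E) := by
    intro x hx
    obtain ⟨z, hz, hzx, hzs⟩ := exists_mem_span_maximal s (fun a ha => (hs a ha).1) hx
    rcases (sub_nonneg.2 hzx).eq_or_lt with h0 | hpos
    · rwa [sub_eq_zero.1 h0.symm]
    obtain ⟨b, hbx, hb⟩ := hdisc _ hpos
    obtain ⟨a, ha, hab⟩ := hmeet b hb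
    have hinf : 0 ≤ a ⊓ b := le_inf (hs a ha).1.le hb.1.le
    obtain ⟨c, hc⟩ := (hs a ha).2 _ hinf inf_le_left
    have hcpos : 0 < c := by
      by_contra! hneg
      refine hab (le_antisymm ?_ hinf)
      rw [hc]
      exact smul_nonpos_of_nonpos_of_nonneg hneg (hs a ha).1.le
    exact absurd ((hc ▸ inf_le_right).trans hbx) (hzs a ha c hcpos)
  refine h ⟨⟨s, Submodule.eq_top_iff'.2 fun x => ?_⟩⟩
  rw [← posPart_sub_negPart x]
  exact Submodule.sub_mem _ (hspan _ (posPart_nonneg x)) (hspan _ (negPart_nonneg x))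

end Discrete

theorem hasPositiveSchurProperty_of_finiteDimensional {E : Type*} [NormedAddCommGroup E]
    [NormedSpace ℝ E] [PartialOrder E] [FiniteDimensional ℝ E] : HasPositiveSchurProperty E := by
  intro x _ hx
  rw [weaklyConvergesTo_iff] at hx
  let b := Module.finBasis ℝ E
  have h1 : Tendsto (fun n => ∑ i, b.coord i (x n) • b i) atTop
      (𝓝 (∑ i, b.coord i 0 • b i)) :=
    tendsto_finsetSum _ fun i _ => (hx (LinearMap.toContinuousLinearMap (b.coord i))).smul_const _
  have h2 : ∀ y : E, ∑ i, b.coord i y • b i = y := fun y => b.sum_repr y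
  simp only [h2] at h1
  simpa using h1.norm

/-! ### Order bounded series with large terms -/

/-- If the norm is not order continuous on sequences, some non-Cauchy decreasing sequence of
positive elements provides, by its differences, an order bounded positive series whose terms stay
away from zero. -/
theorem exists_bounded_series_of_orderContinuousPart_ne_univ {F : Type*} [NormedAddCommGroup F]
    [CompleteSpace F] [Lattice F] [IsOrderedAddMonoid F] [HasSolidNorm F]
    (h : orderContinuousPart F ≠ Set.univ) :
    ∃ (e : F) (v : ℕ → F) (δ : ℝ), 0 < δ ∧ (∀ n, 0 ≤ v n) ∧
      (∀ N, ∑ n ∈ Finset.range N, v n ≤ e) ∧ ∀ n, δ ≤ ‖v n‖ := by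
  rw [Set.ne_univ_iff_exists_notMem] at h
  obtain ⟨x, hx⟩ := h
  simp only [orderContinuousPart, Set.mem_ofPred_eq] at hx
  push Not at hx
  obtain ⟨u, hux, hu, hglb, hlim⟩ := hx
  have hu0 : ∀ n, 0 ≤ u n := fun n => hglb.1 (Set.mem_range_self n)
  have hnc : ¬ CauchySeq u := by
    intro hc
    obtain ⟨a, ha⟩ := cauchySeq_tendsto_of_complete hc
    have ha0 : a = 0 := (isGLB_of_tendsto_atTop hu ha).unique hglb
    exact hlim (by simpa [ha0] using ha.norm)
  rw [Metric.cauchySeq_iff'] at hnc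
  push Not at hnc
  obtain ⟨δ, hδ, hnext⟩ := hnc
  choose k hk hkd using hnext
  let φ : ℕ → ℕ := fun n => k^[n] 0
  have hφ : ∀ n, φ (n + 1) = k (φ n) := fun n => Function.iterate_succ_apply' k n 0
  refine ⟨u 0, fun n => u (φ n) - u (φ (n + 1)), δ, hδ, fun n => ?_, fun N => ?_, fun n => ?_⟩
  · simp only [hφ]; exact sub_nonneg.2 (hu (hk _))
  · rw [Finset.sum_range_sub' fun n => u (φ n)]
    exact sub_le_self _ (hu0 _)
  · simp only [hφ]
    rw [norm_sub_rev, ← dist_eq_norm]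
    exact hkd _

section Series

variable {E : Type*} [NormedAddCommGroup E] [NormedSpace ℝ E] [Lattice E]
  [IsOrderedAddMonoid E] [HasSolidNorm E]
  {F : Type*} [NormedAddCommGroup F] [NormedSpace ℝ F]
  [Lattice F] [IsOrderedAddMonoid F] [IsOrderedModule ℝ F] [HasSolidNorm F]

/-- The operator `x ↦ ∑ f n x • v n`, the sum being an order limit. It factors through `ℓ^∞`. -/
theorem exists_orderSeries_operator (hF : IsDedekindComplete F) {f : ℕ → StrongDual ℝ E}
    (hf : ∀ n x, 0 ≤ x → 0 ≤ f n x) (hf1 : ∀ n x, 0 ≤ x → f n x ≤ ‖x‖)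
    {v : ℕ → F} {e : F} (hv : ∀ n, 0 ≤ v n) (hve : ∀ N, ∑ n ∈ Finset.range N, v n ≤ e) :
    ∃ T : E →L[ℝ] F, (∀ x, 0 ≤ x → T x ≤ ‖x‖ • e) ∧ ∀ n x, 0 ≤ x → f n x • v n ≤ T x := by
  let S : E → ℕ → F := fun x N => ∑ n ∈ Finset.range N, f n x • v n
  have hSmono : ∀ x, 0 ≤ x → Monotone (S x) := fun x hx => monotone_nat_of_le_succ fun N => by
    simp only [S, Finset.sum_range_succ]
    exact le_add_of_nonneg_right (smul_nonneg (hf N x hx) (hv N))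
  have hSe : ∀ x, 0 ≤ x → ∀ N, S x N ≤ ‖x‖ • e := fun x hx N => by
    refine (Finset.sum_le_sum fun n _ => smul_le_smul_of_nonneg_right (hf1 n x hx) (hv n)).trans ?_
    rw [← Finset.smul_sum]
    exact smul_le_smul_of_nonneg_left (hve N) (norm_nonneg x)
  have hex : ∀ x : E, ∃ s : F, 0 ≤ x → IsLUB (Set.range (S x)) s := fun x => by
    by_cases hx : 0 ≤ x
    · obtain ⟨s, hs⟩ := hF (Set.range (S x)) (Set.range_nonempty _)
        ⟨‖x‖ • e, Set.forall_mem_range.2 (hSe x hx)⟩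
      exact ⟨s, fun _ => hs⟩
    · exact ⟨0, fun h => absurd h hx⟩
  choose φ hφ using hex
  have hle : ∀ x, 0 ≤ x → ∀ N, S x N ≤ φ x := fun x hx N => (hφ x hx).1 (Set.mem_range_self N)
  have hub : ∀ x, 0 ≤ x → ∀ b, (∀ N, S x N ≤ b) → φ x ≤ b := fun x hx b hb =>
    (hφ x hx).2 (Set.forall_mem_range.2 hb)
  have hφ0 : ∀ x, 0 ≤ x → 0 ≤ φ x := fun x hx => by simpa [S] using hle x hx 0
  obtain ⟨T, hT⟩ := exists_continuousLinearMap_of_additive_on_nonneg φ (fun x y hx hy => by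
    have hadd : ∀ N, S (x + y) N = S x N + S y N := fun N => by
      simp [S, add_smul, Finset.sum_add_distrib]
    refine le_antisymm (hub _ (add_nonneg hx hy) _ fun N => ?_) ?_
    · rw [hadd]; exact add_le_add (hle x hx N) (hle y hy N)
    · refine le_sub_iff_add_le.1 (hub x hx _ fun N => le_sub_comm.1 (hub y hy _ fun M => ?_))
      refine le_sub_iff_add_le'.2 ((add_le_add (hSmono x hx (le_max_left N M))
        (hSmono y hy (le_max_right N M))).trans ?_)
      rw [← hadd]
      exact hle _ (add_nonneg hx hy) _) ‖e‖ (fun x hx => by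
    have := norm_le_norm_of_nonneg_of_le (hφ0 x hx) (hub x hx _ (hSe x hx))
    rwa [norm_smul, norm_norm, mul_comm] at this)
  refine ⟨T, fun x hx => ?_, fun n x hx => ?_⟩
  · rw [hT x hx]; exact hub x hx _ (hSe x hx)
  · rw [hT x hx]
    refine le_trans ?_ (hle x hx (n + 1))
    simp only [S, Finset.sum_range_succ]
    exact le_add_of_nonneg_left (Finset.sum_nonneg fun i _ => smul_nonneg (hf i x hx) (hv i))

end Series

/-! ### A gliding hump for set functions -/

/-- A sequence of additive set functions `μ n` on `ℕ` that tends to zero setwise, and with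
`μ n` small on subsets of `(n, ∞)`, cannot stay away from zero on the singletons `{n}`. Along a sparse set `range τ` the terms before
and after `τ j` contribute at most `2 * c` each to `μ (τ j) (range τ)`, the diagonal term at least
`8 * c`. -/
theorem false_of_setwise_null_of_diagonal {μ : ℕ → Set ℕ → ℝ} {c : ℝ} (hc : 0 < c)
    (hadd : ∀ n (S S' : Set ℕ), Disjoint S S' → μ n (S ∪ S') = μ n S + μ n S')
    (hnull : ∀ S, Tendsto (fun n => μ n S) atTop (𝓝 0))
    (htail : ∀ n (S : Set ℕ), S ⊆ Set.Ioi n → |μ n S| ≤ 2 * c)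
    (hdiag : ∀ n, 8 * c ≤ |μ n {n}|) : False := by
  have hempty : ∀ n, μ n ∅ = 0 := fun n => by
    have := hadd n ∅ ∅ (Set.disjoint_empty _)
    rw [Set.union_empty] at this
    linarith
  have hfin : ∀ n (s : Finset ℕ), μ n s = ∑ k ∈ s, μ n {k} := by
    intro n s
    induction s using Finset.induction_on with
    | empty => simpa using hempty n
    | insert a s ha ih =>
      rw [Finset.sum_insert ha, Finset.coe_insert, Set.insert_eq, hadd, ih]
      simpa using ha
  obtain ⟨τ, -, hτ⟩ := exists_seq_of_forall_finset_exists (fun _ : ℕ => True)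
    (fun k n => k < n ∧ |μ n {k}| ≤ c * (1 / 2) ^ k) (fun s _ => by
      have h1 : ∀ᶠ n in atTop, ∀ k ∈ s, k < n ∧ |μ n {k}| ≤ c * (1 / 2) ^ k := by
        refine (Finset.eventually_all s).2 fun k _ => (eventually_gt_atTop k).and ?_
        have := (hnull {k}).abs
        rw [abs_zero] at this
        exact this.eventually_le_const (by positivity)
      obtain ⟨n, hn⟩ := h1.exists
      exact ⟨n, trivial, hn⟩)
  have hmono : StrictMono τ := fun i j hij => (hτ i j hij).1
  have hbig : ∀ j, 4 * c ≤ |μ (τ j) (Set.range τ)| := by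
    intro j
    have hsplit : Set.range τ =
        (((Finset.range j).image τ : Finset ℕ) : Set ℕ) ∪ ({τ j} ∪ τ '' Set.Ioi j) := by
      ext k
      simp only [Set.mem_range, Finset.coe_image, Finset.coe_range, Set.mem_union, Set.mem_image,
        Set.mem_Iio, Set.mem_singleton_iff, Set.mem_Ioi]
      constructor
      · rintro ⟨i, rfl⟩
        rcases lt_trichotomy i j with h | h | h
        · exact Or.inl ⟨i, h, rfl⟩
        · exact Or.inr (Or.inl (by rw [h]))
        · exact Or.inr (Or.inr ⟨i, h, rfl⟩)
      · rintro (⟨i, -, rfl⟩ | rfl | ⟨i, -, rfl⟩) <;> exact ⟨_, rfl⟩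
    have hd1 : Disjoint ({τ j} : Set ℕ) (τ '' Set.Ioi j) := by
      rw [Set.disjoint_singleton_left]
      rintro ⟨i, hi, hij⟩
      exact (hmono hi).ne' hij
    have hd2 : Disjoint (((Finset.range j).image τ : Finset ℕ) : Set ℕ)
        ({τ j} ∪ τ '' Set.Ioi j) := by
      rw [Set.disjoint_left]
      intro k hk hk'
      simp only [Finset.coe_image, Finset.coe_range, Set.mem_image, Set.mem_Iio] at hk
      obtain ⟨i, hi, rfl⟩ := hk
      rcases hk' with hk' | ⟨l, hl, hli⟩
      · exact (hmono hi).ne hk'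
      · exact (hmono (hi.trans hl)).ne' hli
    rw [hsplit, hadd _ _ _ hd2, hadd _ _ _ hd1, hfin]
    have hhead : |∑ k ∈ (Finset.range j).image τ, μ (τ j) {k}| ≤ 2 * c := by
      rw [Finset.sum_image fun _ _ _ _ h => hmono.injective h]
      refine (Finset.abs_sum_le_sum_abs _ _).trans ?_
      calc ∑ i ∈ Finset.range j, |μ (τ j) {τ i}|
          ≤ ∑ i ∈ Finset.range j, c * (1 / 2 : ℝ) ^ i := by
            refine Finset.sum_le_sum fun i hi => (hτ i j (Finset.mem_range.1 hi)).2.trans ?_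
            exact mul_le_mul_of_nonneg_left
              (pow_le_pow_of_le_one (by norm_num) (by norm_num) hmono.le_apply) hc.le
        _ = c * ∑ i ∈ Finset.range j, (1 / 2 : ℝ) ^ i := (Finset.mul_sum _ _ _).symm
        _ ≤ 2 * c := by
            rw [mul_comm]
            exact mul_le_mul_of_nonneg_right (sum_geometric_two_le j) hc.le
    have h1 := htail (τ j) (τ '' Set.Ioi j) (by
      rintro _ ⟨i, hi, rfl⟩; exact hmono hi)
    have h2 := hdiag (τ j)
    rw [abs_le] at hhead h1
    rcases le_abs'.1 h2 with h3 | h3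
    · refine le_abs'.2 (Or.inl ?_); linarith
    · refine le_abs'.2 (Or.inr ?_); linarith
  have h0 := ((hnull (Set.range τ)).comp hmono.tendsto_atTop).abs
  rw [abs_zero] at h0
  obtain ⟨j, hj⟩ := (h0.eventually_lt_const (show 0 < 4 * c by linarith)).exists
  exact (hbig j).not_gt hj

/-! ### The Dunford–Pettis argument -/

/-- Banach–Alaoglu in the bidual: a bounded sequence has a limit in the bidual along an
ultrafilter. -/
theorem exists_bidual_limit {X : Type*} [NormedAddCommGroup X] [NormedSpace ℝ X] (U : Ultrafilter ℕ)
    {w : ℕ → X} {C : ℝ} (hw : ∀ N, ‖w N‖ ≤ C) :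
    ∃ B : StrongDual ℝ (StrongDual ℝ X), ∀ ψ : StrongDual ℝ X,
      Tendsto (fun N => ψ (w N)) U (𝓝 (B ψ)) := by
  let J : ℕ → WeakDual ℝ (StrongDual ℝ X) := fun N =>
    StrongDual.toWeakDual (NormedSpace.inclusionInDoubleDual ℝ X (w N))
  have hcomp := WeakDual.isCompact_closedBall (𝕜 := ℝ) (E := StrongDual ℝ X) 0 C
  obtain ⟨B, -, hB⟩ := hcomp.ultrafilter_le_nhds (U.map J) (by
    rw [le_principal_iff]
    refine Filter.mem_map.2 (Filter.univ_mem' fun N => ?_)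
    simp only [Set.mem_preimage, mem_closedBall_zero_iff]
    exact (NormedSpace.double_dual_bound ℝ X (w N)).trans (hw N))
  refine ⟨WeakDual.toStrongDual B, fun ψ => ?_⟩
  exact ((WeakDual.eval_continuous ψ).tendsto B).comp (show Tendsto J U (𝓝 B) from hB)

/-- The supremum of `0` and of the elements `z k`, `k ∈ s`. -/
noncomputable def posSup {F : Type*} [Lattice F] [Zero F] (z : ℕ → F) (s : Finset ℕ) : F :=
  s.fold (· ⊔ ·) 0 z

section PosSup

variable {F : Type*} [AddCommGroup F] [Lattice F]

theorem posSup_insert (z : ℕ → F) {s : Finset ℕ} {a : ℕ} (ha : a ∉ s) :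
    posSup z (insert a s) = z a ⊔ posSup z s := Finset.fold_insert ha

theorem posSup_nonneg (z : ℕ → F) (s : Finset ℕ) : 0 ≤ posSup z s := by
  induction s using Finset.induction_on with
  | empty => exact le_rfl
  | insert a s ha ih => rw [posSup_insert z ha]; exact ih.trans le_sup_right

theorem posSup_le {z : ℕ → F} {s : Finset ℕ} {e : F} (he : 0 ≤ e) (hz : ∀ k ∈ s, z k ≤ e) :
    posSup z s ≤ e := by
  induction s using Finset.induction_on with
  | empty => exact he
  | insert a s ha ih =>
    rw [Finset.forall_mem_insert] at hz
    rw [posSup_insert z ha]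
    exact sup_le hz.1 (ih hz.2)

theorem posSup_le_sum [IsOrderedAddMonoid F] {z : ℕ → F} (hz : ∀ k, 0 ≤ z k) (s : Finset ℕ) :
    posSup z s ≤ ∑ k ∈ s, z k :=
  posSup_le (Finset.sum_nonneg fun k _ => hz k)
    fun _ hk => Finset.single_le_sum (fun i _ => hz i) hk

theorem posSup_Ico (z : ℕ → F) {n N : ℕ} (h : n < N) :
    posSup z (Finset.Ico n N) = z n ⊔ posSup z (Finset.Ico (n + 1) N) := by
  rw [← posSup_insert z (by simp), Finset.insert_Ico_add_one_left_eq_Ico h]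

theorem posSup_Ico_anti (z : ℕ → F) (n N : ℕ) :
    posSup z (Finset.Ico (n + 1) N) ≤ posSup z (Finset.Ico n N) := by
  rcases lt_or_ge n N with h | h
  · rw [posSup_Ico z h]; exact le_sup_right
  · rw [Finset.Ico_eq_empty (by omega), Finset.Ico_eq_empty (by omega)]

/-- The increments of the suprema of the tails of `z 0, …, z (N - 1)`. These are positive, they
telescope, and the `n`-th one differs from `z n` by at most the supremum of the later terms. -/
noncomputable def tailIncrement (z : ℕ → F) (N n : ℕ) : F :=
  posSup z (Finset.Ico n N) - posSup z (Finset.Ico (n + 1) N)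

theorem sum_tailIncrement (z : ℕ → F) {N n : ℕ} (h : n ≤ N) :
    ∑ k ∈ Finset.Ico n N, tailIncrement z N k = posSup z (Finset.Ico n N) := by
  have h1 := Finset.sum_Ico_sub (fun k => -posSup z (Finset.Ico k N)) h
  rw [Finset.Ico_self] at h1
  simp only [neg_sub_neg] at h1
  refine h1.trans ?_
  rw [show posSup z ∅ = 0 from rfl, sub_zero]

/-- The part of the telescoping sum of `tailIncrement z N` with indices in `S`. -/
noncomputable def increments (z : ℕ → F) (N : ℕ) (S : Set ℕ) : F :=
  ∑ k ∈ Finset.range N, S.indicator (tailIncrement z N) k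

theorem increments_union (z : ℕ → F) (N : ℕ) {S S' : Set ℕ} (h : Disjoint S S') :
    increments z N (S ∪ S') = increments z N S + increments z N S' := by
  rw [increments, Set.indicator_union_of_disjoint h, Finset.sum_add_distrib]
  rfl

theorem increments_singleton (z : ℕ → F) {N n : ℕ} (h : n < N) :
    increments z N {n} = tailIncrement z N n := by
  rw [increments, Finset.sum_eq_single_of_mem n (Finset.mem_range.2 h)]
  · exact Set.indicator_of_mem (Set.mem_singleton n) _
  · exact fun k _ hk => Set.indicator_of_notMem (s := {n}) hk _

variable [IsOrderedAddMonoid F]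

theorem tailIncrement_nonneg (z : ℕ → F) (N n : ℕ) : 0 ≤ tailIncrement z N n :=
  sub_nonneg.2 (posSup_Ico_anti z n N)

theorem tailIncrement_le {z : ℕ → F} (hz : ∀ k, 0 ≤ z k) {N n : ℕ} (h : n < N) :
    tailIncrement z N n ≤ z n := by
  rw [tailIncrement, posSup_Ico z h, sub_le_iff_le_add]
  exact sup_le (le_add_of_nonneg_right (posSup_nonneg _ _)) (le_add_of_nonneg_left (hz n))

theorem sub_tailIncrement_le {z : ℕ → F} {N n : ℕ} (h : n < N) :
    z n - tailIncrement z N n ≤ posSup z (Finset.Ico (n + 1) N) := by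
  rw [tailIncrement, posSup_Ico z h, sub_le_comm]
  exact sub_le_sub_right le_sup_left _

theorem increments_nonneg (z : ℕ → F) (N : ℕ) (S : Set ℕ) : 0 ≤ increments z N S :=
  Finset.sum_nonneg fun k _ => Set.indicator_nonneg (fun _ _ => tailIncrement_nonneg z N _) k

theorem increments_le_posSup (z : ℕ → F) (N : ℕ) {n : ℕ} {S : Set ℕ} (hS : S ⊆ Set.Ici n) :
    increments z N S ≤ posSup z (Finset.Ico n N) := by
  have hzero : ∀ k, k < n → S.indicator (tailIncrement z N) k = 0 := fun k hk =>
    Set.indicator_of_notMem (fun hkS => absurd (hS hkS) (not_le.2 hk)) _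
  rcases le_total n N with h | h
  · rw [← sum_tailIncrement z h, increments, Finset.range_eq_Ico,
      ← Finset.sum_Ico_consecutive _ (Nat.zero_le n) h,
      Finset.sum_eq_zero (fun k hk => hzero k (Finset.mem_Ico.1 hk).2), zero_add]
    exact Finset.sum_le_sum fun k _ =>
      Set.indicator_le_self' (fun _ _ => tailIncrement_nonneg z N _) k
  · rw [increments, Finset.sum_eq_zero fun k hk => hzero k ((Finset.mem_range.1 hk).trans_le h)]
    exact posSup_nonneg _ _

end PosSup

section DunfordPettis

variable {F : Type*} [NormedAddCommGroup F] [NormedSpace ℝ F] [Lattice F] [IsOrderedAddMonoid F]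
  [HasSolidNorm F]

/-- The set functions `S ↦ B S (g n)`, where `B S` is the limit in the bidual of the sums of the
increments with indices in `S`, satisfy the hypotheses of the gliding hump. -/
theorem false_of_weaklyNull_of_small_tails {g P : ℕ → StrongDual ℝ F} {z : ℕ → F} {e : F} {c : ℝ}
    (hc : 0 < c) (hg : WeaklyConvergesTo g 0) (hP : ∀ n x, 0 ≤ x → |g n x| ≤ P n x)
    (hz : ∀ n, 0 ≤ z n) (hze : ∀ n, z n ≤ e)
    (hPz : ∀ m n, m < n → P m (z n) ≤ c * (1 / 2) ^ n)
    (hgz : ∀ n, 10 * c ≤ |g n (z n)|) : False := by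
  rw [weaklyConvergesTo_iff] at hg
  have he : 0 ≤ e := (hz 0).trans (hze 0)
  have hP0 : ∀ n x, 0 ≤ x → 0 ≤ P n x := fun n x hx => (abs_nonneg _).trans (hP n x hx)
  have hPM : ∀ n N, P n (posSup z (Finset.Ico (n + 1) N)) ≤ 2 * c := by
    intro n N
    calc P n (posSup z (Finset.Ico (n + 1) N))
        ≤ P n (∑ k ∈ Finset.Ico (n + 1) N, z k) := map_mono_of_nonneg (hP0 n) (posSup_le_sum hz _)
      _ = ∑ k ∈ Finset.Ico (n + 1) N, P n (z k) := map_sum _ _ _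
      _ ≤ ∑ k ∈ Finset.Ico (n + 1) N, c * (1 / 2 : ℝ) ^ k :=
          Finset.sum_le_sum fun k hk => hPz n k (Finset.mem_Ico.1 hk).1
      _ ≤ ∑ k ∈ Finset.range N, c * (1 / 2 : ℝ) ^ k :=
          Finset.sum_le_sum_of_subset_of_nonneg
            (fun k hk => Finset.mem_range.2 (Finset.mem_Ico.1 hk).2) fun _ _ _ => by positivity
      _ = c * ∑ k ∈ Finset.range N, (1 / 2 : ℝ) ^ k := (Finset.mul_sum _ _ _).symm
      _ ≤ 2 * c := by
          rw [mul_comm]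
          exact mul_le_mul_of_nonneg_right (sum_geometric_two_le N) hc.le
  have hbd : ∀ S N, ‖increments z N S‖ ≤ ‖e‖ := fun S N =>
    norm_le_norm_of_nonneg_of_le (increments_nonneg z N S)
      ((increments_le_posSup z N (fun k _ => Nat.zero_le k)).trans
        (posSup_le he fun k _ => hze k))
  choose B hB using fun S => exists_bidual_limit (hyperfilter ℕ) (hbd S)
  refine false_of_setwise_null_of_diagonal (μ := fun n S => B S (g n)) hc ?_ ?_ ?_ ?_
  · intro n S S' h
    refine tendsto_nhds_unique (hB (S ∪ S') (g n)) ?_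
    refine ((hB S (g n)).add (hB S' (g n))).congr fun N => ?_
    rw [increments_union z N h, map_add]
  · intro S
    simpa using hg (B S)
  · intro n S hS
    refine le_of_tendsto' (hB S (g n)).abs fun N => ?_
    refine (hP n _ (increments_nonneg z N S)).trans (le_trans ?_ (hPM n N))
    exact map_mono_of_nonneg (hP0 n) (increments_le_posSup z N hS)
  · intro n
    refine ge_of_tendsto (hB {n} (g n)).abs ?_
    filter_upwards [Nat.hyperfilter_le_atTop (eventually_gt_atTop n)] with N hN
    rw [increments_singleton z hN]
    have h1 := (hP n _ (sub_nonneg.2 (tailIncrement_le hz hN))).trans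
      ((map_mono_of_nonneg (hP0 n) (sub_tailIncrement_le hN)).trans (hPM n N))
    rw [map_sub] at h1
    linarith [hgz n, abs_sub_abs_le_abs_sub (g n (z n)) (g n (tailIncrement z N n))]

/-- Along an order bounded positive sequence on which positive functionals tend to zero, weakly
null sequences of functionals tend to zero. -/
theorem tendsto_zero_of_weaklyNull {g : ℕ → StrongDual ℝ F} (hg : WeaklyConvergesTo g 0)
    {z : ℕ → F} {e : F} (hz : ∀ n, 0 ≤ z n) (hze : ∀ n, z n ≤ e)
    (hnull : ∀ P : StrongDual ℝ F, (∀ x, 0 ≤ x → 0 ≤ P x) →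
      Tendsto (fun n => P (z n)) atTop (𝓝 0)) :
    Tendsto (fun n => g n (z n)) atTop (𝓝 0) := by
  choose P hP _ using fun n => exists_modulus (g n)
  by_contra hcon
  rw [Metric.tendsto_atTop] at hcon
  push Not at hcon
  obtain ⟨ε, hε, hfreq⟩ := hcon
  have hc : 0 < ε / 10 := by positivity
  -- pass to a subsequence whose later terms are negligible for the earlier moduli
  have hnext : ∀ M, ∃ k, M < k ∧ ε ≤ |g k (z k)| ∧
      ∀ m ≤ M, P m (z k) ≤ ε / 10 * (1 / 2) ^ (M + 1) := by
    intro M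
    have h1 : ∀ᶠ k in atTop, ∀ m ∈ Finset.range (M + 1),
        P m (z k) ≤ ε / 10 * (1 / 2) ^ (M + 1) := by
      refine (Finset.eventually_all _).2 fun m _ => ?_
      exact (hnull (P m) fun x hx => (abs_nonneg _).trans (hP m x hx)).eventually_le_const
        (by positivity)
    obtain ⟨K, hK⟩ := eventually_atTop.1 h1
    obtain ⟨k, hk, hkε⟩ := hfreq (max K (M + 1))
    refine ⟨k, (le_max_right K _).trans hk, ?_, fun m hm =>
      hK k ((le_max_left _ _).trans hk) m (Finset.mem_range.2 (Nat.lt_succ_of_le hm))⟩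
    rwa [Real.dist_eq, sub_zero] at hkε
  choose next hlt hbig hsmall using hnext
  let σ : ℕ → ℕ := fun n => next^[n] 0
  have hσ : ∀ n, σ (n + 1) = next (σ n) := fun n => Function.iterate_succ_apply' next n 0
  have hmono : StrictMono σ := strictMono_nat_of_lt_succ fun n => by rw [hσ]; exact hlt _
  have hτ : Tendsto (fun n => σ (n + 1)) atTop atTop :=
    hmono.tendsto_atTop.comp (tendsto_add_atTop_nat 1)
  refine false_of_weaklyNull_of_small_tails (g := fun n => g (σ (n + 1)))
    (P := fun n => P (σ (n + 1))) (z := fun n => z (σ (n + 1))) (e := e) hc (hg.comp hτ)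
    (fun n => hP _) (fun n => hz _) (fun n => hze _) (fun m n hmn => ?_) fun n => ?_
  · simp only [hσ n]
    refine (hsmall (σ n) _ (hmono.monotone hmn)).trans ?_
    refine mul_le_mul_of_nonneg_left ?_ hc.le
    exact pow_le_pow_of_le_one (by norm_num) (by norm_num) (hmono.le_apply.trans (Nat.le_succ _))
  · simp only [hσ n]
    linarith [hbig (σ n)]

end DunfordPettis

/-! ### Operators with order bounded image of the unit ball -/

section Main

variable {E : Type*} [NormedAddCommGroup E] [NormedSpace ℝ E] [Lattice E] [IsOrderedAddMonoid E]
  [HasSolidNorm E]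
  {F : Type*} [NormedAddCommGroup F] [NormedSpace ℝ F] [Lattice F] [IsOrderedAddMonoid F]
  [IsOrderedModule ℝ F] [HasSolidNorm F]

/-- If `T` maps the positive unit ball of `E` below a fixed element `e`, as happens when it
factors through `ℓ^∞`, and the dual of `E` is a KB-space, then `T` is almost M-weakly compact. -/
theorem isAlmostMWeaklyCompact_of_le_norm_smul
    (hE : @IsKBSpace (StrongDual ℝ E) _ (dualPartialOrder E)) {T : E →L[ℝ] F}
    (hT : IsPositiveOperator T) {e : F} (he : 0 ≤ e) (hTe : ∀ x, 0 ≤ x → T x ≤ ‖x‖ • e) :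
    IsAlmostMWeaklyCompact T := by
  intro f g x hfg hx hb
  obtain ⟨C, hC⟩ := isBounded_iff_forall_norm_le.1 hb
  have hxC : ∀ n, ‖x n‖ ≤ C := fun n => hC _ (Set.mem_range_self n)
  have hfg0 : WeaklyConvergesTo (fun n => f n - g) 0 := by
    rw [weaklyConvergesTo_iff] at hfg ⊢
    intro φ
    simpa using (hfg φ).sub_const (φ g)
  have hnn : ∀ y : ℕ → E, (∀ n, 0 ≤ y n) → (∀ n, y n ≤ |x n|) →
      Tendsto (fun n => f n (T (y n))) atTop (𝓝 0) := by
    intro y hy hyx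
    have hyC : ∀ n, ‖y n‖ ≤ C := fun n =>
      (norm_le_norm_of_nonneg_of_le (hy n) (hyx n)).trans ((norm_abs_eq_norm _).le.trans (hxC n))
    have hd : ∀ m n, m ≠ n → y m ⊓ y n = 0 := fun m n hmn =>
      le_antisymm ((inf_le_inf (hyx m) (hyx n)).trans (hx m n hmn).le) (le_inf (hy m) (hy n))
    have hpos : ∀ P : StrongDual ℝ F, (∀ w, 0 ≤ w → 0 ≤ P w) →
        Tendsto (fun n => P (T (y n))) atTop (𝓝 0) := fun P hP =>
      tendsto_zero_of_disjoint_nonneg hE (f := P.comp T) (fun w hw => hP _ (hT w hw)) hy hd hyC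
    have h1 : Tendsto (fun n => (f n - g) (T (y n))) atTop (𝓝 0) :=
      tendsto_zero_of_weaklyNull hfg0 (fun n => hT _ (hy n)) (e := C • e)
        (fun n => (hTe _ (hy n)).trans (smul_le_smul_of_nonneg_right (hyC n) he)) hpos
    obtain ⟨P, hP, -⟩ := exists_modulus g
    have h2 : Tendsto (fun n => g (T (y n))) atTop (𝓝 0) :=
      squeeze_zero_norm (fun n => hP _ (hT _ (hy n)))
        (hpos P fun w hw => (abs_nonneg _).trans (hP w hw))
    simpa using h1.add h2
  have h := (hnn (fun n => (x n)⁺) (fun n => posPart_nonneg _) fun n => posPart_le_abs _).sub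
    (hnn (fun n => (x n)⁻) (fun n => negPart_nonneg _) fun n => negPart_le_abs _)
  rw [sub_zero] at h
  refine h.congr fun n => ?_
  rw [← map_sub, ← map_sub, posPart_sub_negPart]

end Main

end BanachLattice

theorem mainTheorem1
    {E : Type*} [NormedAddCommGroup E] [NormedSpace ℝ E] [CompleteSpace E]
    [Lattice E] [IsOrderedAddMonoid E] [IsOrderedModule ℝ E] [HasSolidNorm E]
    {F : Type*} [NormedAddCommGroup F] [NormedSpace ℝ F] [CompleteSpace F]
    [Lattice F] [IsOrderedAddMonoid F] [IsOrderedModule ℝ F] [HasSolidNorm F]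
    (hE : @BanachLattice.IsKBSpace (StrongDual ℝ E) _ (BanachLattice.dualPartialOrder E))
    (hF : BanachLattice.IsDedekindComplete F)
    (h : ∀ T : E →L[ℝ] F, BanachLattice.IsPositiveOperator T →
      BanachLattice.IsAlmostMWeaklyCompact T → BanachLattice.IsMWeaklyCompact T) :
    BanachLattice.HasPositiveSchurProperty E ∨
      BanachLattice.orderContinuousPart F = Set.univ := by
  open BanachLattice in
  by_contra! hcon
  obtain ⟨hPSP, hFa⟩ := hcon
  obtain ⟨y, hy, hyd⟩ := exists_disjoint_seq_of_not_finiteDimensional (E := E)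
    fun _ => hPSP hasPositiveSchurProperty_of_finiteDimensional
  have hy0 : ∀ n, 0 < ‖y n‖ := fun n => norm_pos_iff.2 (hy n).ne'
  choose f hf hf1 hfy using fun n => exists_nonneg_functional_norming (hy n).le
  obtain ⟨e, v, δ, hδ, hv, hve, hvδ⟩ := exists_bounded_series_of_orderContinuousPart_ne_univ hFa
  obtain ⟨T, hTe, hTv⟩ := exists_orderSeries_operator hF hf hf1 hv hve
  have hT : IsPositiveOperator T := fun x hx =>
    (smul_nonneg (hf 0 x hx) (hv 0)).trans (hTv 0 x hx)
  have he : 0 ≤ e := by simpa using hve 0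
  -- `T` is bounded below on the normalized sequence `x`
  let x : ℕ → E := fun n => ‖y n‖⁻¹ • y n
  have hx : ∀ n, 0 ≤ x n := fun n => smul_nonneg (inv_nonneg.2 (hy0 n).le) (hy n).le
  have hx1 : ∀ n, ‖x n‖ = 1 := fun n => by
    simp [x, norm_smul, (hy0 n).ne']
  have hfx : ∀ n, f n (x n) = 1 := fun n => by
    simp [x, hfy, (hy0 n).ne']
  have hxd : IsDisjointSeq x := fun m n hmn => by
    rw [abs_of_nonneg (hx m), abs_of_nonneg (hx n)]
    exact smul_inf_smul_eq_zero (hy m).le (hy n).le (hyd m n hmn)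
      (inv_nonneg.2 (hy0 m).le) (inv_nonneg.2 (hy0 n).le)
  have hlim := h T hT (isAlmostMWeaklyCompact_of_le_norm_smul hE hT he hTe) x hxd
    (isBounded_iff_forall_norm_le.2 ⟨1, Set.forall_mem_range.2 fun n => (hx1 n).le⟩)
  obtain ⟨n, hn⟩ := (hlim.eventually_lt_const hδ).exists
  refine hn.not_ge ((hvδ n).trans (norm_le_norm_of_nonneg_of_le (hv n) ?_))
  simpa [hfx] using hTv n (x n) (hx n)
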